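/- Let $\mathcal{K}$ be an $\infty$-category (a quasicategory). An $\omega$-diagram in $\mathcal{K}$ is a sequence of vertices and edges $K_0 \xrightarrow{f_0} K_1 \xrightarrow{f_1} K_2 \to \cdots$. A cocone on it consists of a vertex $K$, edges $\delta_{i,\omega}\colon K_i \to K$, and $2$-simplices exhibiting $\delta_{i,\omega}$ as a composite of $f_i$ and $\delta_{i+1,\omega}$ $(i\in\omega)$. It is a colimit if it is an initial vertex of the slice $\infty$-category of $\mathcal{K}$ under the diagram. A functor $F\colon \mathcal{K}\to\mathcal{K}$ (a map of simplicial sets) is $\omega$-continuous if it sends colimit cocones on $\omega$-diagrams to colimit cocones. **Theorem.** Let $F\colon \mathcal{K}\to\mathcal{K}$ be an $\omega$-continuous functor, let $K_0$ be a vertex of $\mathcal{K}$, and let $\delta\colon K_0 \to F K_0$ be an edge. Suppose that $(K, \{\delta_{i,\omega}\colon F^i K_0 \to K\}_{i\in\omega})$ is a colimit of the $\omega$-diagram $(\{F^i K_0\}_{i\in\omega}, \{F^i\delta\}_{i\in\omega})$, where $F^0K_0=K_0$, $F^0\delta=\delta$, and $F^i\delta\colon F^iK_0\to F^{i+1}K_0$.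 Then $K \simeq F K$, that is, there is an edge $K \to FK$ of $\mathcal{K}$ which is an equivalence (has an inverse up to homotopy). -/

import Mathlib

universe u

open CategoryTheory Opposite Simplicial

/-- The functor `[n] ↦ [0] ⋆ [n] = [n + 1]` on the simplex category which adds a new initial
vertex: `α : [m] ⟶ [n]` is sent to the map with `0 ↦ 0` and `i + 1 ↦ α i + 1`. -/
def addInitialVertex : SimplexCategory ⥤ SimplexCategory where
  obj Δ := ⦋Δ.len + 1⦌
  map {Δ Δ'} α := SimplexCategory.mkHom
    { toFun := Fin.cases 0 fun i => (α.toOrderHom i).succ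
      monotone' := by
        intro i j hij
        induction i using Fin.cases with
        | zero => exact Fin.zero_le _
        | succ i =>
          induction j using Fin.cases with
          | zero => exact absurd hij (by simp)
          | succ j =>
            exact Fin.succ_le_succ_iff.2 (α.toOrderHom.monotone (Fin.succ_le_succ_iff.1 hij)) }
  map_id Δ := by
    ext i : 3
    induction i using Fin.cases <;> rfl
  map_comp α β := by
    ext i : 3
    induction i using Fin.cases <;> rfl

lemma delta_zero_addInitialVertex {Δ Δ' : SimplexCategory} (α : Δ ⟶ Δ') :
    SimplexCategory.δ (n := Δ.len) 0 ≫ addInitialVertex.map α =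
      α ≫ SimplexCategory.δ (n := Δ'.len) 0 := by
  ext i : 3
  rfl

lemma addInitialVertex_map_delta_zero (n : ℕ) :
    addInitialVertex.map (SimplexCategory.δ (n := n) 0) = SimplexCategory.δ (n := n + 1) 1 := by
  ext i : 3
  induction i using Fin.cases <;> rfl

lemma delta_zero_addTwoInitialVertices {Δ Δ' : SimplexCategory} (α : Δ ⟶ Δ') :
    SimplexCategory.δ (n := Δ.len + 1) 0 ≫ addInitialVertex.map (addInitialVertex.map α) =
      addInitialVertex.map α ≫ SimplexCategory.δ (n := Δ'.len + 1) 0 :=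
  delta_zero_addInitialVertex (addInitialVertex.map α)

lemma delta_one_addTwoInitialVertices {Δ Δ' : SimplexCategory} (α : Δ ⟶ Δ') :
    SimplexCategory.δ (n := Δ.len + 1) 1 ≫ addInitialVertex.map (addInitialVertex.map α) =
      addInitialVertex.map α ≫ SimplexCategory.δ (n := Δ'.len + 1) 1 := by
  rw [← addInitialVertex_map_delta_zero, ← addInitialVertex_map_delta_zero]
  exact (addInitialVertex.map_comp _ _).symm.trans
    ((congrArg addInitialVertex.map (delta_zero_addInitialVertex α)).trans
      (addInitialVertex.map_comp _ _))

lemma initialEdge_addTwoInitialVertices {Δ Δ' : SimplexCategory} (α : Δ ⟶ Δ') :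
    SimplexCategory.mkOfSucc (n := Δ.len + 2) 0 ≫
        addInitialVertex.map (addInitialVertex.map α) =
      SimplexCategory.mkOfSucc (n := Δ'.len + 2) 0 :=
  SimplexCategory.Hom.ext_one_left _ _ rfl rfl

lemma SSet.map_op_comp_apply (C : SSet.{u}) {X Y Z : SimplexCategory} (f : X ⟶ Y) (g : Y ⟶ Z)
    (x : C.obj (op Z)) : C.map (f ≫ g).op x = C.map f.op (C.map g.op x) := by
  rw [op_comp, C.map_comp]
  rfl

/-- An `ω`-diagram `K₀ ⟶ K₁ ⟶ K₂ ⟶ ⋯` in a simplicial set `C`: a sequence of vertices and edges.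
Equivalently, a map to `C` from the simplicial set `Δ¹ ⊔_{Δ⁰} Δ¹ ⊔_{Δ⁰} ⋯` (the spine of the nerve
of the ordered set `ω`). -/
structure OmegaDiagram (C : SSet.{u}) where
  /-- the vertices `Kᵢ` -/
  obj : ℕ → C _⦋0⦌
  /-- the edges `fᵢ : Kᵢ ⟶ Kᵢ₊₁` -/
  edge : ∀ i, SSet.Edge (obj i) (obj (i + 1))

namespace OmegaDiagram

variable {C C' : SSet.{u}}

/-- The image of an `ω`-diagram under a functor (a map of simplicial sets). -/
def map (D : OmegaDiagram C) (F : C ⟶ C') : OmegaDiagram C' where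
  obj i := F.app _ (D.obj i)
  edge i := (D.edge i).map F

/-- The slice (under) simplicial set `C_{D/}` of an `ω`-diagram `D`, regarded as a map `S ⟶ C`
from the infinite spine `S`. Its `n`-simplices are the maps `S ⋆ Δⁿ ⟶ C` which restrict to `D`
on `S`. As `S` is obtained by glueing copies of `Δ¹` along vertices, `S ⋆ Δⁿ` is obtained by
glueing copies of `Δ¹ ⋆ Δⁿ = Δⁿ⁺²`, indexed by `i : ℕ`, along copies of `Δ⁰ ⋆ Δⁿ = Δⁿ⁺¹`; the
`i`-th copy has vertices `i, i + 1` (of `S`) followed by those of `Δⁿ`. So an `n`-simplex is a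
family of `(n + 2)`-simplices `τ i` of `C` such that the initial edge of `τ i` is the `i`-th edge
of `D`, and the face of `τ i` omitting the vertex `i` is the face of `τ (i + 1)` omitting the
vertex `i + 2`. -/
def under (D : OmegaDiagram C) : SSet.{u} where
  obj Δ := { τ : ℕ → C _⦋Δ.unop.len + 2⦌ //
    (∀ i, C.map (SimplexCategory.mkOfSucc (n := Δ.unop.len + 2) 0).op (τ i) = (D.edge i).edge) ∧
    ∀ i, C.δ 0 (τ i) = C.δ 1 (τ (i + 1)) }
  map {Δ Δ'} α := ↾fun τ => ⟨fun i => C.map (addInitialVertex.map (addInitialVertex.map α.unop)).op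
      (τ.1 i), by
    refine ⟨fun i => ?_, fun i => ?_⟩
    · refine ((C.map_op_comp_apply _ _ _).symm.trans ?_).trans (τ.2.1 i)
      exact congrArg (fun f => C.map (Quiver.Hom.op f) (τ.1 i))
        (initialEdge_addTwoInitialVertices α.unop)
    · refine (C.map_op_comp_apply _ _ _).symm.trans (Eq.trans ?_ (C.map_op_comp_apply _ _ _))
      refine (congrArg (fun f => C.map (Quiver.Hom.op f) (τ.1 i))
        (delta_zero_addTwoInitialVertices α.unop)).trans (Eq.trans ?_
        (congrArg (fun f => C.map (Quiver.Hom.op f) (τ.1 (i + 1)))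
          (delta_one_addTwoInitialVertices α.unop)).symm)
      refine (C.map_op_comp_apply _ _ _).trans (Eq.trans ?_ (C.map_op_comp_apply _ _ _).symm)
      exact congrArg _ (τ.2.2 i)⟩
  map_id Δ := by
    ext τ i
    change C.map (addInitialVertex.map (addInitialVertex.map (𝟙 _))).op (τ.1 i) = τ.1 i
    rw [addInitialVertex.map_id, addInitialVertex.map_id]
    exact ConcreteCategory.congr_hom (C.map_id _) (τ.1 i)
  map_comp α β := by
    ext τ i
    change C.map (addInitialVertex.map (addInitialVertex.map (β.unop ≫ α.unop))).op (τ.1 i) = _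
    rw [addInitialVertex.map_comp, addInitialVertex.map_comp, op_comp, C.map_comp]
    rfl

end OmegaDiagram

/-- A vertex `x` of a simplicial set `X` is initial if every map `∂Δⁿ ⟶ X` with `n ≥ 1` sending
the vertex `0` to `x` extends to `Δⁿ`, i.e. if `X_{x/} ⟶ X` is a trivial Kan fibration. -/
def IsInitialVertex {X : SSet.{u}} (x : X _⦋0⦌) : Prop :=
  ∀ (n : ℕ) (f : (∂Δ[n + 1] : SSet.{u}) ⟶ X),
    f.app (op ⦋0⦌) ⟨SSet.stdSimplex.obj₀Equiv.symm 0, by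
      rw [SSet.boundary_obj_eq_univ 0 (n + 1)]; trivial⟩ = x →
    ∃ g : Δ[n + 1] ⟶ X, (∂Δ[n + 1]).ι ≫ g = f

/-- A cocone on an `ω`-diagram `(Kᵢ, fᵢ)`: a vertex `K`, edges `δᵢ : Kᵢ ⟶ K`, and, for each `i`, a
`2`-simplex exhibiting `δᵢ` as a composite of `fᵢ` and `δᵢ₊₁`. -/
structure OmegaCocone {C : SSet.{u}} (D : OmegaDiagram C) where
  /-- the tip `K` -/
  pt : C _⦋0⦌
  /-- the edges `δᵢ : Kᵢ ⟶ K` -/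
  leg : ∀ i, SSet.Edge (D.obj i) pt
  /-- the `2`-simplices witnessing `δᵢ₊₁ ∘ fᵢ ≃ δᵢ` -/
  triangle : ∀ i, SSet.Edge.CompStruct (D.edge i) (leg (i + 1)) (leg i)

namespace OmegaCocone

variable {C C' : SSet.{u}} {D : OmegaDiagram C}

/-- The image of a cocone under a functor. -/
def map (c : OmegaCocone D) (F : C ⟶ C') : OmegaCocone (D.map F) where
  pt := F.app _ c.pt
  leg i := (c.leg i).map F
  triangle i := (c.triangle i).map F

/-- A cocone, regarded as a vertex of the slice `C_{D/}`. -/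
def toUnder (c : OmegaCocone D) : D.under _⦋0⦌ :=
  ⟨fun i => (c.triangle i).simplex, by
    constructor
    · intro i
      refine Eq.trans ?_ (c.triangle i).d₂
      exact congrArg (fun f => C.map (Quiver.Hom.op f) (c.triangle i).simplex)
        SimplexCategory.mkOfSucc_zero_eq_δ
    · intro i
      exact (c.triangle i).d₀.trans (c.triangle (i + 1)).d₁.symm⟩

/-- A cocone is a colimit cocone if it is an initial vertex of the slice `C_{D/}`. -/
def IsColimit (c : OmegaCocone D) : Prop :=
  IsInitialVertex c.toUnder

end OmegaCocone

/-- A functor is `ω`-continuous if it preserves all (existing) colimits of `ω`-diagrams. -/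
def OmegaContinuous {C C' : SSet.{u}} (F : C ⟶ C') : Prop :=
  ∀ (D : OmegaDiagram C) (c : OmegaCocone D), c.IsColimit → (c.map F).IsColimit

/-- The vertices `Fⁱ K₀`. -/
def iterVertex {C : SSet.{u}} (F : C ⟶ C) (K₀ : C _⦋0⦌) (i : ℕ) : C _⦋0⦌ :=
  match i with
  | 0 => K₀
  | i + 1 => F.app (op ⦋0⦌) (iterVertex F K₀ i)

/-- The edges `Fⁱ δ : Fⁱ K₀ ⟶ Fⁱ⁺¹ K₀`. -/
def iterEdge {C : SSet.{u}} (F : C ⟶ C) {K₀ : C _⦋0⦌}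
    (δ : SSet.Edge K₀ (F.app (op ⦋0⦌) K₀)) (i : ℕ) :
    SSet.Edge (iterVertex F K₀ i) (iterVertex F K₀ (i + 1)) :=
  match i with
  | 0 => δ
  | i + 1 => (iterEdge F δ i).map F

/-- The `ω`-diagram `K₀ ⟶ F K₀ ⟶ F² K₀ ⟶ ⋯` with edges `Fⁱ δ`. -/
def iterDiagram {C : SSet.{u}} (F : C ⟶ C) {K₀ : C _⦋0⦌}
    (δ : SSet.Edge K₀ (F.app (op ⦋0⦌) K₀)) : OmegaDiagram C where
  obj := iterVertex F K₀
  edge := iterEdge F δ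

/-- Two vertices of an `∞`-category are equivalent if there is an edge between them which has an
inverse up to homotopy. -/
def VertexEquiv {C : SSet.{u}} (x y : C _⦋0⦌) : Prop :=
  ∃ e : SSet.Edge x y, Nonempty e.InvStruct

/-! Let `D` be the diagram of the `F^i K₀`. Applying `F` to `D` gives `D` without its first vertex,
so by continuity `F K` is a colimit of `D.shift`. It remains to see that dropping the first vertex
does not change the colimit up to equivalence. Restriction from the slice under `D` to the slice
under `D.shift` lifts vertices (`underShift_surjective`, filling `Λ²₁`) and edges with prescribed
endpoints (`exists_edge_underShift`, filling `Λ³₁`). Lift the cocone on `F K` to a vertex `z` under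
`D`. Initiality of `K` gives an edge `K ⟶ z`; initiality of `F K` gives an edge back between the
restrictions, which lifts. One composite is homotopic to the identity by initiality of `K` under
`D`, the other by initiality of `F K` under `D.shift`. Forgetting the diagram carries the
equivalence to `C`. -/

/-! ### Maps out of boundaries of simplices -/

/-- The boundary `∂Δⁿ` is the multicoequalizer of the faces of `Δⁿ` of codimension one along their
intersections. -/
lemma SSet.boundary.multicoequalizerDiagram (n : ℕ) :
    Subcomplex.MulticoequalizerDiagram (∂Δ[n] : (Δ[n] : SSet.{u}).Subcomplex)
      (fun j : Fin (n + 1) ↦ stdSimplex.face {j}ᶜ) (fun j k ↦ stdSimplex.face {j, k}ᶜ) where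
  iSup_eq := by rw [boundary_eq_iSup]
  eq_inf j k := by
    rw [stdSimplex.face_inter_face]
    congr
    aesop

open Limits in
/-- A compatible family of simplices of dimension `n + 1` glues to a map `∂Δⁿ⁺² ⟶ X`. -/
lemma SSet.boundary.exists_desc {X : SSet.{u}} {n : ℕ} (f : Fin (n + 3) → X _⦋n + 1⦌)
    (hf : ∀ (j k : Fin (n + 3)) (hjk : j < k),
      X.δ (k.pred (Fin.ne_zero_of_lt hjk)) (f j) =
        X.δ (j.castPred (Fin.ne_last_of_lt hjk)) (f k)) :
    ∃ φ : (∂Δ[n + 2] : SSet.{u}) ⟶ X, ∀ j, yonedaEquiv (boundary.ι j ≫ φ) = f j := by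
  let m : Multicofork ((boundary.multicoequalizerDiagram _).multispanIndex.toLinearOrder.map
      Subcomplex.toSSetFunctor) :=
    Multicofork.ofπ _ X
      (fun j ↦ (stdSimplex.faceSingletonComplIso j).inv ≫ yonedaEquiv.symm (f j)) (by
      rintro ⟨⟨a, b⟩, hab : a < b⟩
      refine (stdSimplex.homOfLE_faceSingletonComplIso_inv_eq_facePairComplIso_inv_δ_pred_assoc
        a b hab _).trans (Eq.trans ?_
        (stdSimplex.homOfLE_faceSingletonComplIso_inv_eq_facePairComplIso_inv_δ_castPred_assoc
          a b hab _).symm)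
      rw [stdSimplex.δ_comp_yonedaEquiv_symm, stdSimplex.δ_comp_yonedaEquiv_symm]
      exact congrArg (fun s ↦ _ ≫ yonedaEquiv.symm s) (hf a b hab))
  refine ⟨(boundary.multicoequalizerDiagram _).isColimit'.desc m, fun j ↦ ?_⟩
  rw [← Equiv.eq_symm_apply, ← cancel_epi (stdSimplex.faceSingletonComplIso j).inv]
  exact (faceSingletonComplIso_inv_ι_assoc j _).trans
    ((boundary.multicoequalizerDiagram _).isColimit'.fac m (.right j))

open Limits in
/-- Two vertices assemble to a map `∂Δ¹ ⟶ X`. -/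
lemma SSet.boundary.exists_desc_one {X : SSet.{u}} (f : Fin 2 → X _⦋0⦌) :
    ∃ φ : (∂Δ[1] : SSet.{u}) ⟶ X, ∀ j, yonedaEquiv (boundary.ι j ≫ φ) = f j := by
  let m : Multicofork ((boundary.multicoequalizerDiagram _).multispanIndex.toLinearOrder.map
      Subcomplex.toSSetFunctor) :=
    Multicofork.ofπ _ X
      (fun j ↦ (stdSimplex.faceSingletonComplIso j).inv ≫ yonedaEquiv.symm (f j)) (by
      rintro ⟨⟨a, b⟩, hab : a < b⟩
      obtain ⟨rfl, rfl⟩ : a = 0 ∧ b = 1 := by lia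
      -- The two vertices of `Δ¹` are disjoint: a simplex of their intersection would have a vertex
      -- outside `{0, 1}`, so there is nothing to check.
      ext ⟨⟨k⟩⟩ ⟨x, hx⟩
      have h : x ∈ (stdSimplex.face ({0, 1}ᶜ : Finset (Fin 2))).obj _ := hx
      have h' := (stdSimplex.mem_face_iff _ _).1 h 0
      generalize (x : Fin (k + 1) → Fin 2) 0 = y at h'
      fin_cases y <;> simp at h')
  refine ⟨(boundary.multicoequalizerDiagram _).isColimit'.desc m, fun j ↦ ?_⟩
  rw [← Equiv.eq_symm_apply, ← cancel_epi (stdSimplex.faceSingletonComplIso j).inv]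
  exact (faceSingletonComplIso_inv_ι_assoc j _).trans
    ((boundary.multicoequalizerDiagram _).isColimit'.fac m (.right j))

/-! ### Edges and triangles out of an initial vertex -/

namespace IsInitialVertex

variable {X : SSet.{u}} {x : X _⦋0⦌}

/-- The condition on the vertex `0` is tested on any one face containing it: `α` picks the vertex of
the `j`-th face that is the vertex `0` of the whole simplex. -/
lemma exists_simplex {n : ℕ} (hx : IsInitialVertex x) (f : (∂Δ[n + 1] : SSet.{u}) ⟶ X)
    (α : ⦋0⦌ ⟶ ⦋n⦌) (j : Fin (n + 2)) (hα : j.succAbove (α.toOrderHom 0) = 0)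
    (hf : X.map α.op (SSet.yonedaEquiv (SSet.boundary.ι j ≫ f)) = x) :
    ∃ s : X _⦋n + 1⦌, ∀ j, X.δ j s = SSet.yonedaEquiv (SSet.boundary.ι j ≫ f) := by
  obtain ⟨g, rfl⟩ := hx n f (by
    rw [← hf, SSet.yonedaEquiv_naturality]
    change f.app _ _ = f.app _ _
    congr 1
    apply Subtype.ext
    apply SSet.stdSimplex.obj₀Equiv.injective
    rw [Equiv.apply_symm_apply, ← hα]
    rfl)
  refine ⟨SSet.yonedaEquiv g, fun j ↦ ?_⟩
  rw [SSet.boundary.ι_ι_assoc, SSet.stdSimplex.yonedaEquiv_δ_comp]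

lemma nonempty_edge (hx : IsInitialVertex x) (y : X _⦋0⦌) : Nonempty (SSet.Edge x y) := by
  -- Face `j` of `Δ¹` is the vertex opposite to `j`, so the target comes first.
  obtain ⟨f, hf⟩ := SSet.boundary.exists_desc_one ![y, x]
  obtain ⟨s, hs⟩ := hx.exists_simplex f (𝟙 _) 1 (by decide) (by
    rw [hf]
    exact ConcreteCategory.congr_hom (X.map_id _) x)
  exact ⟨.mk s ((hs 1).trans (hf 1)) ((hs 0).trans (hf 0))⟩

lemma nonempty_compStruct (hx : IsInitialVertex x) {y z : X _⦋0⦌} (e₀₁ : SSet.Edge x y)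
    (e₁₂ : SSet.Edge y z) (e₀₂ : SSet.Edge x z) :
    Nonempty (SSet.Edge.CompStruct e₀₁ e₁₂ e₀₂) := by
  obtain ⟨f, hf⟩ := SSet.boundary.exists_desc ![e₁₂.edge, e₀₂.edge, e₀₁.edge] (by
    intro j k hjk
    obtain ⟨rfl, rfl⟩ | ⟨rfl, rfl⟩ | ⟨rfl, rfl⟩ :
      j = 0 ∧ k = 1 ∨ j = 0 ∧ k = 2 ∨ j = 1 ∧ k = 2 := by lia
    · exact e₁₂.tgt_eq.trans e₀₂.tgt_eq.symm
    · exact e₁₂.src_eq.trans e₀₁.tgt_eq.symm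
    · exact e₀₂.src_eq.trans e₀₁.src_eq.symm)
  obtain ⟨s, hs⟩ := hx.exists_simplex f (SimplexCategory.δ 1) 2 (by decide) (by
    rw [hf]
    exact e₀₁.src_eq)
  exact ⟨.mk s ((hs 2).trans (hf 2)) ((hs 0).trans (hf 0)) ((hs 1).trans (hf 1))⟩

end IsInitialVertex

lemma SSet.δ_δ_apply (C : SSet.{u}) {n : ℕ} {i j : Fin (n + 2)} (h : i ≤ j) (x : C _⦋n + 2⦌) :
    C.δ i (C.δ j.succ x) = C.δ j (C.δ i.castSucc x) :=
  ConcreteCategory.congr_hom (C.δ_comp_δ h) x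

/-! ### Inner horn filling in dimensions 2 and 3 -/

namespace SSet.Quasicategory

variable {C : SSet.{u}} [Quasicategory C]

lemma exists_two_simplex (e₀₁ e₁₂ : C _⦋1⦌) (h : C.δ 1 e₁₂ = C.δ 0 e₀₁) :
    ∃ s : C _⦋2⦌, C.δ 0 s = e₁₂ ∧ C.δ 2 s = e₀₁ := by
  obtain ⟨f, h₀₁, h₁₂⟩ := horn₂₁.isPushout.exists_desc
    (yonedaEquiv.symm e₀₁) (yonedaEquiv.symm e₁₂) (by
      rw [stdSimplex.δ_comp_yonedaEquiv_symm, stdSimplex.δ_comp_yonedaEquiv_symm, h])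
  obtain ⟨g, rfl⟩ := hornFilling (by decide) (by decide) f
  rw [horn.ι_ι_assoc, Equiv.eq_symm_apply, stdSimplex.yonedaEquiv_δ_comp] at h₀₁ h₁₂
  exact ⟨_, h₁₂, h₀₁⟩

lemma exists_three_simplex (f₀ f₂ f₃ : C _⦋2⦌) (h₁₂ : C.δ 2 f₀ = C.δ 0 f₃)
    (h₁₃ : C.δ 1 f₀ = C.δ 0 f₂) (h₂₃ : C.δ 2 f₂ = C.δ 2 f₃) :
    ∃ s : C _⦋3⦌, C.δ 0 s = f₀ ∧ C.δ 2 s = f₂ ∧ C.δ 3 s = f₃ := by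
  obtain ⟨f, h₀, h₂, h₃⟩ := horn₃₁.exists_desc
    (yonedaEquiv.symm f₀) (yonedaEquiv.symm f₂) (yonedaEquiv.symm f₃)
    (by rw [stdSimplex.δ_comp_yonedaEquiv_symm, stdSimplex.δ_comp_yonedaEquiv_symm, h₁₂])
    (by rw [stdSimplex.δ_comp_yonedaEquiv_symm, stdSimplex.δ_comp_yonedaEquiv_symm, h₁₃])
    (by rw [stdSimplex.δ_comp_yonedaEquiv_symm, stdSimplex.δ_comp_yonedaEquiv_symm, h₂₃])
  obtain ⟨g, rfl⟩ := hornFilling (by decide) (by decide) f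
  rw [horn.ι_ι_assoc, Equiv.eq_symm_apply, stdSimplex.yonedaEquiv_δ_comp] at h₀ h₂ h₃
  exact ⟨_, h₀, h₂, h₃⟩

end SSet.Quasicategory

/-! ### Lifting along restriction to the shifted diagram -/

namespace OmegaDiagram

variable {C : SSet.{u}} (D : OmegaDiagram C)

/-- The `ω`-diagram `K₁ ⟶ K₂ ⟶ ⋯` obtained by forgetting the first vertex. -/
def shift : OmegaDiagram C where
  obj i := D.obj (i + 1)
  edge i := D.edge (i + 1)

/-- The restriction map from the slice under `D` to the slice under its shift. -/
def underShift : D.under ⟶ D.shift.under where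
  app _ := ↾fun τ => ⟨fun i => τ.1 (i + 1), fun i => τ.2.1 (i + 1), fun i => τ.2.2 (i + 1)⟩
  naturality _ _ _ := rfl

/-- The map from the slice under `D` to `C` which forgets the diagram. -/
def underForget : D.under ⟶ C where
  app _ := ↾fun τ => C.δ 0 (C.δ 0 (τ.1 0))
  naturality Δ Δ' α := by
    ext τ
    change C.δ 0 (C.δ 0 (C.map _ _)) = C.map α (C.δ 0 (C.δ 0 (τ.1 0)))
    have h : ∀ {Δ Δ' : SimplexCategory} (α : Δ ⟶ Δ') (s : C _⦋Δ'.len + 1⦌),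
        C.δ 0 (C.map (addInitialVertex.map α).op s) = C.map α.op (C.δ 0 s) := fun α s =>
      (C.map_op_comp_apply _ _ _).symm.trans ((congrArg (fun f => C.map (Quiver.Hom.op f) s)
        (delta_zero_addInitialVertex α)).trans (C.map_op_comp_apply _ _ _))
    exact (congrArg (C.δ 0) (h (addInitialVertex.map α.unop) (τ.1 0))).trans
      (h α.unop (C.δ 0 (τ.1 0)))

variable {D}

/-- The two diagram vertices come first in each `τ i`, which shifts face indices by two. -/
lemma under_δ_apply {n : ℕ} (j : Fin (n + 2)) (τ : D.under _⦋n + 1⦌) (i : ℕ) :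
    (D.under.δ j τ).1 i = C.δ j.succ.succ (τ.1 i) := by
  have h : ∀ {n : ℕ} (j : Fin (n + 2)),
      addInitialVertex.map (SimplexCategory.δ j) = SimplexCategory.δ j.succ := by
    intro n j
    ext k : 3
    induction k using Fin.cases with
    | zero => exact (Fin.succ_succAbove_zero j).symm
    | succ k => exact (Fin.succ_succAbove_succ j k).symm
  change C.map (addInitialVertex.map (addInitialVertex.map (SimplexCategory.δ j))).op (τ.1 i) = _
  rw [h]
  exact congrArg (fun f => C.map (Quiver.Hom.op f) (τ.1 i)) (h j.succ)

lemma under_initialEdge (a : D.under _⦋0⦌) (i : ℕ) : C.δ 2 (a.1 i) = (D.edge i).edge := by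
  rw [← a.2.1 i]
  exact congrArg (fun f => C.map (Quiver.Hom.op f) (a.1 i)) SimplexCategory.mkOfSucc_zero_eq_δ.symm

variable [SSet.Quasicategory C]

/-- Every cocone on the shift of `D` extends to a cocone on `D`. -/
lemma underShift_surjective (z : D.shift.under _⦋0⦌) :
    ∃ a : D.under _⦋0⦌, D.underShift.app _ a = z := by
  -- The missing leg is a composite of the first edge of `D` with the leg out of `K₁`, which is the
  -- face `C.δ 1 (z.1 0)`.
  obtain ⟨s, h₀, h₂⟩ := SSet.Quasicategory.exists_two_simplex (D.edge 0).edge (C.δ 1 (z.1 0)) (by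
    refine (C.δ_δ_apply (i := 1) (j := 1) le_rfl _).symm.trans ?_
    exact ((congrArg (C.δ 1) (under_initialEdge z 0)).trans (D.edge 1).src_eq).trans
      (D.edge 0).tgt_eq.symm)
  refine ⟨⟨fun i => Nat.casesOn i s z.1, fun i => ?_, fun i => ?_⟩, rfl⟩
  · cases i with
    | zero =>
      exact (congrArg (fun f => C.map (Quiver.Hom.op f) s)
        SimplexCategory.mkOfSucc_zero_eq_δ).trans h₂
    | succ i => exact z.2.1 i
  · cases i with
    | zero => exact h₀
    | succ i => exact z.2.2 i

/-- Edges of the slice under the shift of `D` lift to the slice under `D`, with prescribed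
endpoints. -/
lemma exists_edge_underShift {a b : D.under _⦋0⦌}
    (e : SSet.Edge (D.underShift.app _ a) (D.underShift.app _ b)) :
    ∃ e' : SSet.Edge a b, e'.map D.underShift = e := by
  have ha (i : ℕ) : C.δ 3 (e.edge.1 i) = a.1 (i + 1) :=
    (under_δ_apply 1 e.edge i).symm.trans (congrArg (fun t => t.1 i) e.src_eq)
  have hb (i : ℕ) : C.δ 2 (e.edge.1 i) = b.1 (i + 1) :=
    (under_δ_apply 0 e.edge i).symm.trans (congrArg (fun t => t.1 i) e.tgt_eq)
  -- The new simplex has vertices `K₀`, `K₁` and the tips of `a` and `b`. Its faces 0, 2 and 3 are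
  -- prescribed by `e`, `b` and `a`; only face 1, omitting `K₁`, is free.
  obtain ⟨s, h₀, h₂, h₃⟩ := SSet.Quasicategory.exists_three_simplex
    (C.δ 1 (e.edge.1 0)) (b.1 0) (a.1 0)
    (by
      refine Eq.trans ?_ (a.2.2 0).symm
      rw [← ha]
      exact (C.δ_δ_apply (i := 1) (j := 2) (by decide) _).symm)
    (by
      refine Eq.trans ?_ (b.2.2 0).symm
      rw [← hb]
      exact (C.δ_δ_apply (i := 1) (j := 1) (by decide) _).symm)
    ((under_initialEdge b 0).trans (under_initialEdge a 0).symm)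
  let t : D.under _⦋1⦌ := ⟨fun i => Nat.casesOn i s e.edge.1, by
    intro i
    cases i with
    | zero =>
      rw [← under_initialEdge a 0, ← h₃]
      refine Eq.trans ?_ (C.map_op_comp_apply (SimplexCategory.δ 2) (SimplexCategory.δ 3) s)
      exact congrArg (fun f => C.map (Quiver.Hom.op f) s)
        (SimplexCategory.Hom.ext_one_left _ _ rfl rfl)
    | succ i => exact e.edge.2.1 i, by
    intro i
    cases i with
    | zero => exact h₀
    | succ i => exact e.edge.2.2 i⟩
  refine ⟨.mk t (Subtype.ext (funext fun i => ?_)) (Subtype.ext (funext fun i => ?_)),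
    SSet.Edge.ext rfl⟩
  · rw [under_δ_apply]
    cases i with
    | zero => exact h₃
    | succ i => exact ha i
  · rw [under_δ_apply]
    cases i with
    | zero => exact h₂
    | succ i => exact hb i

end OmegaDiagram

/-! ### Comparison of the two colimits -/

namespace OmegaCocone

variable {C : SSet.{u}} {D : OmegaDiagram C}

lemma underForget_toUnder (c : OmegaCocone D) : D.underForget.app _ c.toUnder = c.pt :=
  (congrArg (C.δ 0) (c.triangle 0).d₀).trans (c.leg 1).tgt_eq

/-- The cocone on the shifted diagram obtained by forgetting the first leg. -/
def shift (c : OmegaCocone D) : OmegaCocone D.shift where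
  pt := c.pt
  leg i := c.leg (i + 1)
  triangle i := c.triangle (i + 1)

/-- The tips of a colimit cocone on `D` and of a colimit cocone on the shift of `D` are
equivalent. -/
lemma IsColimit.vertexEquiv_shift [SSet.Quasicategory C] {c : OmegaCocone D} (hc : c.IsColimit)
    {c' : OmegaCocone D.shift} (hc' : c'.IsColimit) : VertexEquiv c.pt c'.pt := by
  obtain ⟨z, hz⟩ := D.underShift_surjective c'.toUnder
  obtain ⟨e⟩ := IsInitialVertex.nonempty_edge hc z
  have hz' : IsInitialVertex (D.underShift.app _ z) := hz ▸ hc'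
  obtain ⟨f'⟩ := hz'.nonempty_edge (D.underShift.app _ c.toUnder)
  obtain ⟨f, rfl⟩ := OmegaDiagram.exists_edge_underShift f'
  -- The triangle `s` lives under `D`, where `c` is initial; `t` is built only after restriction,
  -- where the image of `z` is initial.
  obtain ⟨s⟩ := IsInitialVertex.nonempty_compStruct hc e f (.id _)
  obtain ⟨t⟩ := hz'.nonempty_compStruct (f.map _) (e.map D.underShift) (.id _)
  let I : (e.map D.underShift).InvStruct :=
    { inv := f.map _
      homInvId := (s.map D.underShift).ofEq rfl rfl (SSet.Edge.ext_iff.1 (SSet.Edge.map_id _ _))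
      invHomId := t }
  -- The restriction of `c.toUnder` is definitionally `c.shift.toUnder`.
  have h : VertexEquiv (D.shift.underForget.app _ c.shift.toUnder)
      (D.shift.underForget.app _ (D.underShift.app _ z)) :=
    ⟨_, ⟨I.map D.shift.underForget⟩⟩
  rwa [hz, underForget_toUnder, underForget_toUnder] at h

end OmegaCocone

theorem theorem2p1 (C : SSet.{u}) [SSet.Quasicategory C] (F : C ⟶ C) (hF : OmegaContinuous F)
    (K₀ : C _⦋0⦌) (δ : SSet.Edge K₀ (F.app (op ⦋0⦌) K₀))
    (K : OmegaCocone (iterDiagram F δ)) (hK : K.IsColimit) :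
    VertexEquiv K.pt (F.app (op ⦋0⦌) K.pt) :=
  -- `(iterDiagram F δ).map F` and `(iterDiagram F δ).shift` agree definitionally, so `K.map F` is a
  -- cocone on the shift.
  hK.vertexEquiv_shift (c' := K.map F) (hF _ K hK)
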